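/- Let $\mathbb F_q$ be a finite field, let $n,k,s$ be positive integers with $q>sn$, let $\gamma\in\mathbb F_q^\ast$ have multiplicative order at least $sn$ (for instance, $\gamma$ primitive), and let $\alpha_1,\dots,\alpha_n\in\mathbb F_q^\ast$ be distinct elements with $\alpha_i\gamma^t\neq\alpha_j$ for all $i\ne j$ and $0\le t<s$. The $s$-folded Reed–Solomon code with message length $k$ on these points is the code $\mathcal C\subseteq(\mathbb F_q^s)^n$ of all words $\bigl((f(\alpha_i),f(\alpha_i\gamma),\dots,f(\alpha_i\gamma^{s-1}))\bigr)_{i=1}^n$ with $f\in\mathbb F_q[x]$, $\deg f<k$. Its rate is $R(\mathcal C)=\frac{1}{n}\log_{q^s}|\mathcal C|$. Write $\Delta(x,y)=|\{i: x_i\ne y_i\}|/n$ for words $x,y\in(\mathbb F_q^s)^n$, $\Delta(x,S)=\min_{y\in S}\Delta(x,y)$ for a set $S$ of words (with $\Delta(x,\emptyset)=+\infty$), and $$\mathsf{LIST}(\mathcal C,\delta,L_1\times\cdots\times L_n)=\{c\in\mathcal C:\Delta(c,L_1\times\cdots\times L_n)\le\delta\}.$$ Theorem. There is an absolute constant $K>0$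 such that for every $\ell\in\mathbb N$, $\varepsilon>0$, $R>0$, every $s$-folded Reed–Solomon code $\mathcal C$ as above of rate $R(\mathcal C)=R$ with $s>s_0:=\frac{16(R+\varepsilon)\ell}{\varepsilon^2}$, and all $L_1,\dots,L_n\subseteq\mathbb F_q^s$ with $|L_i|=\ell$ for each $i$, $$\bigl|\mathsf{LIST}(\mathcal C,1-R-\varepsilon,L_1\times\cdots\times L_n)\bigr|\le K\cdot\frac{\ell}{\varepsilon^2}\cdot\ell^{\,2\ln\left(\frac{2e\ell}{R+\varepsilon}\right)\cdot\frac{R+\varepsilon}{\varepsilon}}.$$ -/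

import Mathlib

open Polynomial

/-- Fractional Hamming distance of two words of length `n` over the alphabet `A`. -/
noncomputable def fracDist {A : Type*} {n : ℕ} (x y : Fin n → A) : ℝ :=
  open Classical in (hammingDist x y : ℝ) / n

/-- Fractional Hamming distance of a word to a set of words. It takes values in the extended
reals so that the distance to the empty set is `⊤`; on non-empty sets the infimum is a minimum. -/
noncomputable def fracDistToSet {A : Type*} {n : ℕ} (x : Fin n → A) (S : Set (Fin n → A)) :
    EReal :=
  ⨅ y ∈ S, ((fracDist x y : ℝ) : EReal)

/-- The rate `log_{|A|} |C| / n` of a code `C ⊆ A ^ n`. -/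
noncomputable def codeRate {A : Type*} {n : ℕ} (C : Set (Fin n → A)) : ℝ :=
  Real.logb (Nat.card A) C.ncard / n

/-- The list of codewords within fractional distance `δ` of the product `L₁ × ⋯ × Lₙ`. -/
def recoveryList {A : Type*} {n : ℕ} (C : Set (Fin n → A)) (δ : ℝ)
    (L : Fin n → Finset A) : Set (Fin n → A) :=
  {c | c ∈ C ∧ fracDistToSet c (Set.univ.pi fun i => (L i : Set A)) ≤ (δ : EReal)}

/-- Admissible folding parameter and evaluation points of an `s`-folded Reed–Solomon code of
length `n`. Every primitive element `γ` satisfies `order`, because of `card_lt`. -/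
structure IsFRSPoints {F : Type*} [Field F] (s : ℕ) {n : ℕ} (γ : F) (α : Fin n → F) : Prop where
  card_lt : s * n < Nat.card F
  order : s * n ≤ orderOf γ
  ne_zero : ∀ i, α i ≠ 0
  injective : Function.Injective α
  disjoint : ∀ i j, i ≠ j → ∀ t < s, α i * γ ^ t ≠ α j

/-- The `s`-folded Reed–Solomon code with message length `k`: the `i`-th symbol of the codeword of
`f` is the column `(f(αᵢ), f(αᵢ γ), …, f(αᵢ γ ^ (s - 1)))`. -/
def frsCode {F : Type*} [Field F] (s k : ℕ) {n : ℕ} (γ : F) (α : Fin n → F) :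
    Set (Fin n → Fin s → F) :=
  {c | ∃ f : F[X], f.degree < (k : WithBot ℕ) ∧ ∀ i t, c i t = f.eval (α i * γ ^ (t : ℕ))}

/-- The infimum in the distance to a set is attained. -/
theorem fracDistToSet_le_iff {A : Type*} {n : ℕ} (x : Fin n → A) (S : Set (Fin n → A)) (δ : ℝ) :
    fracDistToSet x S ≤ (δ : EReal) ↔ ∃ y ∈ S, fracDist x y ≤ δ := by
  classical
  constructor
  · intro h
    by_contra! hlt
    rcases S.eq_empty_or_nonempty with rfl | hS
    · simp [fracDistToSet] at h
    · have hfin : (fracDist x '' S).Finite := by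
        refine Set.Finite.subset
          ((Finset.range (n + 1)).finite_toSet.image fun m : ℕ => (m : ℝ) / n) ?_
        rintro _ ⟨y, -, rfl⟩
        refine ⟨hammingDist x y, ?_, ?_⟩
        · have := hammingDist_le_card_fintype (x := x) (y := y)
          simp only [Fintype.card_fin] at this
          simpa using Nat.lt_succ_of_le this
        · simp only [fracDist]
      obtain ⟨y, hy, hmin⟩ := Set.exists_min_image _ id hfin (hS.image _)
      obtain ⟨z, hz, rfl⟩ := hy
      have h1 : ((fracDist x z : ℝ) : EReal) ≤ fracDistToSet x S := by
        refine le_iInf₂ fun w hw => ?_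
        exact_mod_cast hmin _ ⟨w, hw, rfl⟩
      have h2 : fracDist x z ≤ δ := by exact_mod_cast h1.trans h
      exact absurd h2 (not_le.mpr (hlt z hz))
  · rintro ⟨y, hy, h⟩
    exact (iInf₂_le y hy).trans (by exact_mod_cast h)

/-! The columns of a folded Reed–Solomon codeword are linear maps on the polynomials of degree less
than k. The list bound uses them only through the subspace design property, with density ρ = R + ε/2
up to dimension D = ⌈2ℓ/ε⌉. That property comes from the folded Wronskian of an r-dimensional space
U (`sum_finrank_inf_le`): it is non-zero of degree at most rk, while each kernel meeting U in
dimension m forces s - r + 1 roots of multiplicity m.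

Put κ = R + ε, so that listed words agree with the lists on a κ fraction of the coordinates. By
`IsSubspaceDesign.finrank_vectorSpan_lt` they span an affine space of dimension less than D, since D
+ 1 independent words would agree with the lists too often.

`IsSubspaceDesign.card_le` then bounds their number by induction on the dimension d. Fixing
coordinate i to one of its ℓ list values lowers the dimension to some m_i. Agreements are double
counted, coordinate i having weight ℓ^(h(d) - 1 - h(m_i)), with h the function `listExponent b`. For
large d single weights may be below 1; it is enough that, for each word, the exponents have
non-negative sum over its agreements. The m_i average at most ρd over all coordinates, so a typical
agreement lowers the dimension by a constant proportion. Hence h only has to satisfy h(d) - h(m) ≥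
(b/d)(d - m) beyond b, and may grow like b log d instead of d. -/

/-! ### Subspace designs and the exponent function -/

open Module in
/-- A family of linear maps `e i` on `V` is a subspace design of density `ρ` up to dimension `D` if
for every subspace `U` of dimension at most `D` the kernels `U ⊓ ker (e i)` have average dimension
at most `ρ * dim U`. -/
def IsSubspaceDesign {F V A ι : Type*} [Field F] [AddCommGroup V] [Module F V] [AddCommGroup A]
    [Module F A] [Fintype ι] (e : ι → V →ₗ[F] A) (ρ : ℝ) (D : ℕ) : Prop :=
  ∀ U : Submodule F V, finrank F U ≤ D →
    ∑ i, (finrank F ↥(U ⊓ LinearMap.ker (e i)) : ℝ) ≤ ρ * finrank F U * Fintype.card ι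

/-- The exponent in the list-size bound: linear up to `b`, then logarithmic. -/
noncomputable def listExponent (b x : ℝ) : ℝ :=
  if x ≤ b then x else b * (1 + Real.log (x / b))

theorem listExponent_nonneg {b x : ℝ} (hb : 0 < b) (hx : 0 ≤ x) : 0 ≤ listExponent b x := by
  unfold listExponent
  split_ifs with h
  · exact hx
  · push Not at h
    have : 0 ≤ Real.log (x / b) := Real.log_nonneg ((one_le_div hb).2 h.le)
    positivity

theorem listExponent_le_self {b x : ℝ} (hb : 0 < b) : listExponent b x ≤ x := by
  unfold listExponent
  split_ifs with h
  · exact le_rfl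
  · push Not at h
    have h1 := Real.log_le_sub_one_of_pos (div_pos (hb.trans h) hb)
    calc b * (1 + Real.log (x / b)) ≤ b * (x / b) := by gcongr; linarith
      _ = x := by field_simp

/-- Above `b`, the exponent lies below its tangents. -/
theorem listExponent_le_tangent {b d x : ℝ} (hb : 0 < b) (hd : b < d) :
    listExponent b x ≤ listExponent b d - b / d * (d - x) := by
  have hd0 : 0 < d := hb.trans hd
  have hdb : listExponent b d = b * (1 + Real.log (d / b)) := by
    simp [listExponent, not_le.2 hd]
  rw [hdb]
  unfold listExponent
  split_ifs with h
  -- On the linear branch the slope 1 exceeds b/d, so the worst case is x = b, where the claim is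
  -- log y ≤ y - 1 at y = b/d.
  · have h1 := Real.log_le_sub_one_of_pos (div_pos hb hd0)
    have h2 : Real.log (d / b) = -Real.log (b / d) := by rw [← Real.log_inv, inv_div]
    have h3 : 0 ≤ (1 - b / d) * (b - x) :=
      mul_nonneg (by rw [sub_nonneg, div_le_one hd0]; exact hd.le) (by linarith)
    have h4 : b / d * (d - x) = b - b / d * x := by field_simp
    have h5 : b * Real.log (b / d) ≤ b * (b / d - 1) := by gcongr
    rw [h2, h4]
    nlinarith
  · push Not at h
    have hx0 : 0 < x := hb.trans h
    have h1 := Real.log_le_sub_one_of_pos (div_pos hx0 hd0)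
    have h2 : Real.log (x / b) = Real.log (d / b) + Real.log (x / d) := by
      rw [← Real.log_mul (by positivity) (by positivity)]
      congr 1
      field_simp
    have h4 : b / d * (d - x) = b - b * (x / d) := by field_simp
    have h5 : b * Real.log (x / d) ≤ b * (x / d - 1) := by gcongr
    rw [h2, h4]
    linarith

theorem listExponent_le_of_le {b x y : ℝ} (hb : 0 < b) (hby : b ≤ y) (hxy : x ≤ y) :
    listExponent b x ≤ b * (1 + Real.log (y / b)) := by
  have hy : 0 ≤ Real.log (y / b) := Real.log_nonneg ((one_le_div hb).2 hby)
  unfold listExponent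
  split_ifs with h
  · nlinarith
  · push Not at h
    have : 0 < x := hb.trans h
    gcongr

/-! ### List recovery in subspace designs -/

section Counting

open Module

variable {F V A ι : Type*} [Field F] [AddCommGroup V] [Module F V] [FiniteDimensional F V]
  [AddCommGroup A] [Module F A]

open Classical in
/-- If `T` is affinely independent and `#S` of its members take one of `ℓ` values under `f`,
then the kernel of `f` on the direction of `T` has dimension at least `#S - ℓ`. -/
theorem AffineIndependent.card_filter_le_finrank_inf_ker_add (f : V →ₗ[F] A) (T : Finset V)
    (hT : AffineIndependent F ((↑) : T → V)) (L : Finset A) :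
    (T.filter fun c => f c ∈ L).card ≤
      finrank F ↥(vectorSpan F (T : Set V) ⊓ LinearMap.ker f) + L.card := by
  set S := T.filter fun c => f c ∈ L with hS
  have hST : S ⊆ T := Finset.filter_subset _ _
  rcases S.eq_empty_or_nonempty with h0 | ⟨c, hc⟩
  · simp [h0]
  have hSi : AffineIndependent F ((↑) : S → V) :=
    AffineIndependent.mono (t := (T : Set V)) (s := (S : Set V)) hT (by exact_mod_cast hST)
  set W := vectorSpan F (S : Set V) with hW
  have hSn : Nonempty S := ⟨⟨c, hc⟩⟩
  -- The points of `S` and their images each span one dimension less than their number allows; these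
  -- two losses cancel in rank-nullity.
  have h1 : finrank F W + 1 = S.card := by
    have := hSi.finrank_vectorSpan_add_one
    rw [Subtype.range_coe_subtype] at this
    simpa using this
  have hL : (S.image f).card ≤ L.card := Finset.card_le_card fun y hy => by
    obtain ⟨x, hx, rfl⟩ := Finset.mem_image.1 hy
    exact (Finset.mem_filter.1 hx).2
  have himg : (S.image f).Nonempty := ⟨f c, Finset.mem_image_of_mem f hc⟩
  have h2 : finrank F (W.map f) + 1 ≤ (S.image f).card := by
    have h3 : W.map f = vectorSpan F ((S.image f : Finset A) : Set A) := by
      rw [Finset.coe_image]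
      exact AffineMap.map_vectorSpan f.toAffineMap
    rw [h3]
    have : Nonempty (S.image f) := himg.to_subtype
    have := finrank_vectorSpan_range_add_one_le F ((↑) : (S.image f) → A)
    rw [Subtype.range_coe_subtype] at this
    simpa using this
  have h4 := LinearMap.finrank_range_add_finrank_ker (f.domRestrict W)
  rw [LinearMap.range_domRestrict] at h4
  have h5 : finrank F (LinearMap.ker (f.domRestrict W)) ≤
      finrank F ↥(vectorSpan F (T : Set V) ⊓ LinearMap.ker f) := by
    rw [← Submodule.finrank_map_subtype_eq W]
    refine Submodule.finrank_mono ?_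
    rintro _ ⟨x, hx, rfl⟩
    refine ⟨vectorSpan_mono F (by exact_mod_cast hST) x.2, ?_⟩
    simpa using hx
  omega

variable [Fintype ι]

open Classical in
/-- For a subspace design, the words that agree with a product of small lists on many coordinates
span a low-dimensional affine space. -/
theorem IsSubspaceDesign.finrank_vectorSpan_lt {e : ι → V →ₗ[F] A} {ρ κ : ℝ} {D ℓ : ℕ}
    (he : IsSubspaceDesign e ρ D) (hι : 0 < Fintype.card ι) (hκ : 0 < κ)
    (hD0 : 0 < D) (hD : (ℓ : ℝ) ≤ D * (κ - ρ)) {L : ι → Finset A} (hL : ∀ i, (L i).card = ℓ) {T : Finset V}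
    (hT : ∀ c ∈ T, κ * Fintype.card ι ≤ (Finset.univ.filter fun i => e i c ∈ L i).card) :
    finrank F (vectorSpan F (T : Set V)) < D := by
  by_contra! hle
  obtain ⟨t, htT, hspan, hti⟩ := exists_affineIndependent F V (T : Set V)
  have htf : t.Finite := T.finite_toSet.subset htT
  lift t to Finset V using htf
  have hdir : vectorSpan F (t : Set V) = vectorSpan F (T : Set V) := by
    rw [← direction_affineSpan, hspan, direction_affineSpan]
  have htne : t.Nonempty := by
    by_contra! h
    subst h
    rw [← hdir, Finset.coe_empty, vectorSpan_empty, finrank_bot] at hle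
    omega
  have hcard : D + 1 ≤ t.card := by
    have : Nonempty t := htne.to_subtype
    have := AffineIndependent.finrank_vectorSpan_add_one (k := F) (p := ((↑) : t → V)) hti
    rw [Subtype.range_coe_subtype, Fintype.card_coe] at this
    change finrank F (vectorSpan F (t : Set V)) + 1 = _ at this
    rw [hdir] at this
    omega
  -- Exactly D + 1 points, so that their direction has dimension D and the design property still
  -- applies.
  obtain ⟨S, hSt, hS⟩ := Finset.exists_subset_card_eq hcard
  have hSi : AffineIndependent F ((↑) : S → V) :=
    AffineIndependent.mono (t := (t : Set V)) (s := (S : Set V)) hti (by exact_mod_cast hSt)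
  have hfr : finrank F (vectorSpan F (S : Set V)) = D := by
    have := hSi.finrank_vectorSpan (n := D) (by simpa using hS)
    rwa [Subtype.range_coe_subtype] at this
  have h1 := he _ hfr.le
  rw [hfr] at h1
  have h2 : ∀ i, ((S.filter fun c => e i c ∈ L i).card : ℝ) ≤
      finrank F ↥(vectorSpan F (S : Set V) ⊓ LinearMap.ker (e i)) + ℓ := fun i => by
    have := hSi.card_filter_le_finrank_inf_ker_add (e i) S (L i)
    rw [hL] at this
    exact_mod_cast this
  have h3 := Finset.sum_le_sum fun i (_ : i ∈ Finset.univ) => h2 i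
  have h4 : ∑ i, ((S.filter fun c => e i c ∈ L i).card : ℝ) =
      ∑ c ∈ S, ((Finset.univ.filter fun i => e i c ∈ L i).card : ℝ) := by
    simp only [Finset.card_filter, Nat.cast_sum]
    exact Finset.sum_comm
  have h5 : (D + 1 : ℝ) * (κ * Fintype.card ι) ≤
      ∑ c ∈ S, ((Finset.univ.filter fun i => e i c ∈ L i).card : ℝ) := by
    have := Finset.card_nsmul_le_sum S
      (fun c => ((Finset.univ.filter fun i => e i c ∈ L i).card : ℝ)) (κ * Fintype.card ι)
      fun c hc => hT c (htT (hSt hc))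
    rw [hS] at this
    simpa using this
  rw [h4, Finset.sum_add_distrib, Finset.sum_const, Finset.card_univ, nsmul_eq_mul] at h3
  -- The contradiction, with N coordinates: (D + 1)κN ≤ ρDN + ℓN ≤ DκN.
  have hN : (0 : ℝ) < Fintype.card ι := by exact_mod_cast hι
  nlinarith

open Classical in
/-- In a subspace design, an affine space of dimension `d` contains at most
`ℓ ^ listExponent b d * (a * d + 1)` words that agree with a product of lists of size `ℓ` on a `κ`
fraction of the coordinates. -/
theorem IsSubspaceDesign.card_le {e : ι → V →ₗ[F] A} {ρ κ a b : ℝ} {D ℓ : ℕ}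
    (he : IsSubspaceDesign e ρ D) (hι : 0 < Fintype.card ι) (hℓ : 0 < ℓ) (hκ : 0 < κ)
    (hρκ : ρ < κ) (ha : 1 ≤ a * (κ - ρ)) (hb : 0 < b) (hbκ : κ ≤ b * (κ - ρ))
    {L : ι → Finset A} (hL : ∀ i, (L i).card = ℓ) (d : ℕ) (hd : d ≤ D) (U : Submodule F V)
    (hU : finrank F U = d) (T : Finset V) (hTU : ∀ c ∈ T, ∀ c' ∈ T, c - c' ∈ U)
    (hT : ∀ c ∈ T, κ * Fintype.card ι ≤ (Finset.univ.filter fun i => e i c ∈ L i).card) :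
    (T.card : ℝ) ≤ (ℓ : ℝ) ^ listExponent b d * (a * d + 1) := by
  induction d using Nat.strong_induction_on generalizing U T with
  | _ d ih =>
  have hℓ0 : (0 : ℝ) < ℓ := by exact_mod_cast hℓ
  have hℓ1 : (1 : ℝ) ≤ ℓ := by exact_mod_cast hℓ
  have hN : (0 : ℝ) < Fintype.card ι := by exact_mod_cast hι
  have ha0 : 0 < a := pos_of_mul_pos_left (one_pos.trans_le ha) (sub_pos.2 hρκ).le
  rcases Nat.eq_zero_or_pos d with rfl | hd0
  · have hU0 : U = ⊥ := Submodule.finrank_eq_zero.1 hU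
    have hT1 : T.card ≤ 1 := Finset.card_le_one.2 fun c hc c' hc' => by
      have := hTU c hc c' hc'
      rw [hU0, Submodule.mem_bot, sub_eq_zero] at this
      exact this
    have h1 : (1 : ℝ) ≤ (ℓ : ℝ) ^ listExponent b ((0 : ℕ) : ℝ) :=
      Real.one_le_rpow hℓ1 (listExponent_nonneg hb (by simp))
    have h2 : (T.card : ℝ) ≤ 1 := by exact_mod_cast hT1
    simp only [Nat.cast_zero, mul_zero, zero_add, mul_one] at h1 ⊢
    linarith
  set N : ℝ := (Fintype.card ι : ℝ) with hNdef
  set m : ι → ℕ := fun i => finrank F ↥(U ⊓ LinearMap.ker (e i)) with hm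
  have hdR : (0 : ℝ) < d := by exact_mod_cast hd0
  have hmd : ∀ i, m i ≤ d := fun i => hU ▸ Submodule.finrank_mono inf_le_left
  -- On the remaining P coordinates all of `T` takes a single value, so fixing it does not lower the
  -- dimension. They use up P·d of the kernel dimension that the design allows.
  set J := Finset.univ.filter fun i => m i < d with hJ
  set P : ℝ := ((Finset.univ.filter fun i => ¬ m i < d).card : ℝ) with hP
  have hP0 : 0 ≤ P := by positivity
  have hJP : (J.card : ℝ) + P = N := by
    rw [hJ, hP, hNdef, ← Nat.cast_add, Finset.card_filter_add_card_filter_not, Finset.card_univ]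
  have hsum : ∑ i ∈ J, (m i : ℝ) ≤ d * (ρ * N - P) := by
    have h1 := he U (hU ▸ hd)
    rw [hU, ← Finset.sum_filter_add_sum_filter_not Finset.univ (fun i => m i < d)] at h1
    have h2 : ∑ i ∈ Finset.univ.filter (fun i => ¬ m i < d), (m i : ℝ) = P * d := by
      rw [hP, ← nsmul_eq_mul]
      refine Finset.sum_eq_card_nsmul fun i hi => ?_
      have := (Finset.mem_filter.1 hi).2
      have h3 := hmd i
      have : m i = d := by omega
      exact_mod_cast this
    change ∑ i ∈ J, (m i : ℝ) + ∑ i ∈ Finset.univ.filter (fun i => ¬ m i < d), (m i : ℝ) ≤ _ at h1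
    rw [h2] at h1
    linarith
  have hρP : 0 ≤ ρ * N - P := by
    have : 0 ≤ ∑ i ∈ J, (m i : ℝ) := by positivity
    exact nonneg_of_mul_nonneg_right (this.trans hsum) hdR
  set M : ℝ := κ * N - P with hM
  have hM0 : 0 < M := by
    have : ρ * N < κ * N := by gcongr
    linarith
  set S : V → Finset ι := fun c => J.filter fun i => e i c ∈ L i with hS
  have hSM : ∀ c ∈ T, M ≤ (S c).card := fun c hc => by
    have h1 := hT c hc
    have h2 : (Finset.univ.filter fun i => e i c ∈ L i) ⊆
        S c ∪ Finset.univ.filter fun i => ¬ m i < d := fun i hi => by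
      have hi' := (Finset.mem_filter.1 hi).2
      simp only [hS, hJ, Finset.mem_union, Finset.mem_filter, Finset.mem_univ, true_and]
      tauto
    have h3 := (Finset.card_le_card h2).trans (Finset.card_union_le _ _)
    have h4 : ((Finset.univ.filter fun i => e i c ∈ L i).card : ℝ) ≤ (S c).card + P := by
      rw [hP]
      exact_mod_cast h3
    linarith
  set h := listExponent b with hh
  -- Every word keeps total weight at least M, although single weights may be small: by e^x ≥ 1 + x
  -- it suffices that the exponents have non-negative sum. For d ≤ b each exponent is non-negative;
  -- beyond b only the sum is.
  have hgain : ∀ c ∈ T, M ≤ ∑ i ∈ S c, (ℓ : ℝ) ^ (h d - 1 - h (m i)) := fun c hc => by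
    have hexp : 0 ≤ ∑ i ∈ S c, (h d - 1 - h (m i)) := by
      by_cases hdb : (d : ℝ) ≤ b
      · refine Finset.sum_nonneg fun i hi => ?_
        have h1 : m i < d := (Finset.mem_filter.1 (Finset.mem_filter.1 hi).1).2
        have h2 : (m i : ℝ) + 1 ≤ d := by exact_mod_cast h1
        have h3 : h d = d := by simp [hh, listExponent, hdb]
        have h4 : h (m i) ≤ m i := listExponent_le_self hb
        linarith
      · push Not at hdb
        have h1 : ∑ i ∈ S c, (b / d * (d - m i) - 1) ≤ ∑ i ∈ S c, (h d - 1 - h (m i)) := by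
          refine Finset.sum_le_sum fun i _ => ?_
          have := listExponent_le_tangent (x := m i) hb hdb
          linarith
        refine le_trans ?_ h1
        rw [Finset.sum_sub_distrib, ← Finset.mul_sum, Finset.sum_sub_distrib, Finset.sum_const,
          Finset.sum_const, nsmul_eq_mul, nsmul_eq_mul, mul_one]
        have h2 : ∑ i ∈ S c, (m i : ℝ) ≤ d * (ρ * N - P) :=
          (Finset.sum_le_sum_of_subset_of_nonneg (Finset.filter_subset _ _)
            fun i _ _ => by positivity).trans hsum
        -- The tangent bound makes the sum at least (b - 1)|S c| - b(ρN - P). As b ≥ 1 and |S c| ≥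
        -- κN - P, this is at least b(κ - ρ)N - κN + P ≥ 0.
        have h3 := hSM c hc
        have h4 : b / d * ((S c).card * d - d * (ρ * N - P)) =
            b * ((S c).card - (ρ * N - P)) := by field_simp
        have h5 : b / d * ((S c).card * d - d * (ρ * N - P)) ≤
            b / d * ((S c).card * d - ∑ i ∈ S c, (m i : ℝ)) := by gcongr
        have h6 : κ * N ≤ b * (κ - ρ) * N := by gcongr
        have h7 : 1 ≤ b := by
          have hρ0 : 0 ≤ ρ := nonneg_of_mul_nonneg_left (by linarith : 0 ≤ ρ * N) hN
          by_contra! hb1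
          nlinarith
        have h8 : 0 ≤ (b - 1) * ((S c).card - M) :=
          mul_nonneg (by linarith) (by linarith)
        nlinarith
    have h1 : ∀ i ∈ S c, 1 + Real.log ℓ * (h d - 1 - h (m i)) ≤
        (ℓ : ℝ) ^ (h d - 1 - h (m i)) := fun i _ => by
      rw [Real.rpow_def_of_pos hℓ0]
      linarith [Real.add_one_le_exp (Real.log ℓ * (h d - 1 - h (m i)))]
    refine (hSM c hc).trans (le_trans ?_ (Finset.sum_le_sum h1))
    rw [Finset.sum_add_distrib, ← Finset.mul_sum, Finset.sum_const, nsmul_eq_mul, mul_one]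
    have := mul_nonneg (Real.log_nonneg hℓ1) hexp
    linarith
  -- Induction applies to each of the ℓ fibres; the factor ℓ is what the -1 in the weight exponent
  -- pays for.
  have hcoord : ∀ i ∈ J, ((T.filter fun c => e i c ∈ L i).card : ℝ) ≤
      ℓ * ((ℓ : ℝ) ^ h (m i) * (a * m i + 1)) := fun i hi => by
    have hmi : m i < d := (Finset.mem_filter.1 hi).2
    have h1 : (T.filter fun c => e i c ∈ L i).card =
        ∑ y ∈ L i, ((T.filter fun c => e i c ∈ L i).filter fun c => e i c = y).card :=
      Finset.card_eq_sum_card_fiberwise fun c hc => (Finset.mem_filter.1 hc).2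
    rw [h1, Nat.cast_sum, ← hL i, ← nsmul_eq_mul (L i).card]
    refine Finset.sum_le_card_nsmul _ _ _ fun y _ => ?_
    rw [hL i]
    refine ih (m i) hmi (hmi.le.trans hd) (U ⊓ LinearMap.ker (e i)) rfl _ ?_ ?_
    · intro c hc c' hc'
      simp only [Finset.mem_filter] at hc hc'
      refine ⟨hTU c hc.1.1 c' hc'.1.1, ?_⟩
      rw [SetLike.mem_coe, LinearMap.mem_ker, map_sub, hc.2, hc'.2, sub_self]
    · intro c hc
      simp only [Finset.mem_filter] at hc
      exact hT c hc.1.1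
  have hdouble : (T.card : ℝ) * M ≤
      ∑ i ∈ J, (ℓ : ℝ) ^ (h d - 1 - h (m i)) * ((T.filter fun c => e i c ∈ L i).card : ℝ) := by
    have h1 := Finset.card_nsmul_le_sum T _ M hgain
    rw [nsmul_eq_mul] at h1
    refine h1.trans (le_of_eq ?_)
    simp only [hS, Finset.sum_filter, Finset.card_filter, Nat.cast_sum, Finset.mul_sum]
    rw [Finset.sum_comm]
    refine Finset.sum_congr rfl fun i _ => Finset.sum_congr rfl fun c _ => ?_
    split_ifs <;> simp
  have hbound : (T.card : ℝ) * M ≤ ∑ i ∈ J, (ℓ : ℝ) ^ h d * (a * m i + 1) := by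
    refine hdouble.trans (Finset.sum_le_sum fun i hi => ?_)
    calc (ℓ : ℝ) ^ (h d - 1 - h (m i)) * ((T.filter fun c => e i c ∈ L i).card : ℝ)
        ≤ (ℓ : ℝ) ^ (h d - 1 - h (m i)) * (ℓ * ((ℓ : ℝ) ^ h (m i) * (a * m i + 1))) := by
          gcongr
          exact hcoord i hi
      _ = (ℓ : ℝ) ^ (h d - 1 - h (m i)) * (ℓ : ℝ) ^ (1 : ℝ) * (ℓ : ℝ) ^ h (m i) *
            (a * m i + 1) := by rw [Real.rpow_one]; ring
      _ = (ℓ : ℝ) ^ h d * (a * m i + 1) := by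
          rw [← Real.rpow_add hℓ0, ← Real.rpow_add hℓ0]
          congr 2
          ring
  rw [← Finset.mul_sum, Finset.sum_add_distrib, ← Finset.mul_sum, Finset.sum_const, nsmul_eq_mul,
    mul_one] at hbound
  -- P cancels from the two sides, leaving N ≤ ad(κ - ρ)N + κN, which follows from a(κ - ρ) ≥ 1 and
  -- d ≥ 1.
  have hlast : a * ∑ i ∈ J, (m i : ℝ) + J.card ≤ (a * d + 1) * M := by
    have h1 : a * ∑ i ∈ J, (m i : ℝ) ≤ a * (d * (ρ * N - P)) := by gcongr
    have h2 : 1 * (d * N) ≤ a * (κ - ρ) * (d * N) := by gcongr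
    have h3 : N ≤ d * N := le_mul_of_one_le_left hN.le (by exact_mod_cast hd0)
    have h4 : 0 < κ * N := by positivity
    nlinarith
  refine le_of_mul_le_mul_right ?_ hM0
  calc (T.card : ℝ) * M ≤ (ℓ : ℝ) ^ h d * (a * ∑ i ∈ J, (m i : ℝ) + J.card) := hbound
    _ ≤ (ℓ : ℝ) ^ h d * ((a * d + 1) * M) := by gcongr
    _ = _ := by ring

open Classical in
/-- The list-size bound for subspace designs of density `κ - ε / 2`, without reference to an ambient
affine space. -/
theorem IsSubspaceDesign.card_le_of_ceil_le {e : ι → V →ₗ[F] A} {κ ε : ℝ} {D ℓ : ℕ}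
    (he : IsSubspaceDesign e (κ - ε / 2) D) (hι : 0 < Fintype.card ι) (hℓ : 0 < ℓ) (hε : 0 < ε)
    (hκ : 0 < κ) (hD : 2 * ℓ / ε ≤ D) {L : ι → Finset A} (hL : ∀ i, (L i).card = ℓ) (T : Finset V)
    (hT : ∀ c ∈ T, κ * Fintype.card ι ≤ (Finset.univ.filter fun i => e i c ∈ L i).card) :
    ∃ d < D, (T.card : ℝ) ≤ (ℓ : ℝ) ^ listExponent (2 * κ / ε) d * (2 / ε * d + 1) := by
  have hℓ0 : (0 : ℝ) < ℓ := by exact_mod_cast hℓ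
  have hgap : κ - (κ - ε / 2) = ε / 2 := by ring
  have hD0 : 0 < D := by
    have : (0 : ℝ) < D := lt_of_lt_of_le (by positivity) hD
    exact_mod_cast this
  have hlt : finrank F (vectorSpan F (T : Set V)) < D := by
    refine he.finrank_vectorSpan_lt hι hκ hD0 ?_ hL hT
    rw [hgap]
    calc (ℓ : ℝ) = 2 * ℓ / ε * (ε / 2) := by field_simp
      _ ≤ D * (ε / 2) := by gcongr
  refine ⟨_, hlt, he.card_le hι hℓ hκ (by linarith) ?_ (by positivity) ?_ hL _ hlt.le _ rfl T
    (fun c hc c' hc' => vsub_mem_vectorSpan F hc hc') hT⟩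
  · rw [hgap]
    exact (by field_simp : (1 : ℝ) = 2 / ε * (ε / 2)).le
  · rw [hgap]
    exact (by field_simp : κ = 2 * κ / ε * (ε / 2)).le

end Counting

/-! ### Folded Wronskians -/

section Wronskian

open Module

variable {F : Type*} [Field F]

/-- The matrix of the dilations `b j (γ ^ i * X)`, whose determinant is the folded Wronskian. -/
noncomputable def foldedWronskianMatrix {r : ℕ} (γ : F) (b : Fin r → F[X]) :
    Matrix (Fin r) (Fin r) F[X] :=
  Matrix.of fun j i => (b j).comp (C (γ ^ (i : ℕ)) * X)

theorem foldedWronskianMatrix_apply {r : ℕ} (γ : F) (b : Fin r → F[X]) (j i : Fin r) :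
    foldedWronskianMatrix γ b j i = (b j).comp (C (γ ^ (i : ℕ)) * X) := rfl

theorem Polynomial.natDegree_comp_C_mul_X_le (f : F[X]) (a : F) :
    (f.comp (C a * X)).natDegree ≤ f.natDegree := by
  refine natDegree_comp_le.trans ?_
  exact (Nat.mul_le_mul_left _ ((natDegree_C_mul_le a X).trans natDegree_X_le)).trans (mul_one _).le

/-- The top coefficient of a product, computed from upper bounds on the degrees. -/
theorem Polynomial.coeff_prod_of_forall_natDegree_le {R ι : Type*} [CommRing R] (s : Finset ι)
    (f : ι → R[X]) (d : ι → ℕ) (h : ∀ i ∈ s, (f i).natDegree ≤ d i) :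
    (∏ i ∈ s, f i).coeff (∑ i ∈ s, d i) = ∏ i ∈ s, (f i).coeff (d i) := by
  classical
  induction s using Finset.induction_on with
  | empty => simp
  | insert a s ha ih =>
    rw [Finset.prod_insert ha, Finset.sum_insert ha, Finset.prod_insert ha,
      coeff_mul_add_eq_of_natDegree_le (h a (by simp)), ih fun i hi => h i (by simp [hi])]
    exact (natDegree_prod_le _ _).trans
      (Finset.sum_le_sum fun i hi => h i (by simp [hi]))

theorem natDegree_det_foldedWronskianMatrix_le {r : ℕ} (γ : F) (b : Fin r → F[X]) :
    (foldedWronskianMatrix γ b).det.natDegree ≤ ∑ j, (b j).natDegree := by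
  rw [← Matrix.det_transpose, Matrix.det_apply]
  refine natDegree_sum_le_of_forall_le _ _ fun σ _ => ?_
  refine (natDegree_smul_le _ _).trans ((natDegree_prod_le _ _).trans ?_)
  exact Finset.sum_le_sum fun j _ => (b j).natDegree_comp_C_mul_X_le _

/-- The folded Wronskian of polynomials of distinct degrees below the order of `γ` is non-zero:
its top coefficient is a Vandermonde determinant. -/
theorem det_foldedWronskianMatrix_ne_zero {r : ℕ} {γ : F} {b : Fin r → F[X]} (hb : ∀ j, b j ≠ 0)
    (hinj : Function.Injective fun j => (b j).natDegree)
    (hlt : ∀ j, (b j).natDegree < orderOf γ) : (foldedWronskianMatrix γ b).det ≠ 0 := by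
  intro h0
  have h1 : (foldedWronskianMatrix γ b).det.coeff (∑ j, (b j).natDegree) =
      (Matrix.of fun j i : Fin r =>
        (b j).leadingCoeff * Matrix.vandermonde (fun j => γ ^ (b j).natDegree) j i).det := by
    rw [← Matrix.det_transpose, Matrix.det_apply, ← Matrix.det_transpose, Matrix.det_apply,
      finsetSum_coeff]
    refine Finset.sum_congr rfl fun σ _ => ?_
    rw [Units.smul_def, Units.smul_def, coeff_smul]
    congr 1
    simp only [Matrix.transpose_apply, foldedWronskianMatrix_apply]
    rw [coeff_prod_of_forall_natDegree_le _ _ _ fun j _ => (b j).natDegree_comp_C_mul_X_le _]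
    refine Finset.prod_congr rfl fun j _ => ?_
    simp only [Matrix.of_apply,
      Matrix.vandermonde_apply, comp_C_mul_X_coeff, coeff_natDegree]
    rw [← pow_mul, ← pow_mul, mul_comm (σ j : ℕ)]
  rw [h0, coeff_zero, Matrix.det_mul_column, eq_comm, mul_eq_zero] at h1
  rcases h1 with h1 | h1
  · obtain ⟨j, -, hj⟩ := Finset.prod_eq_zero_iff.1 h1
    exact hb j (leadingCoeff_eq_zero.1 hj)
  · refine Matrix.det_vandermonde_ne_zero_iff.2 (fun i j hij => hinj ?_) h1
    exact pow_injOn_Iio_orderOf (hlt i) (hlt j) hij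

/-- A change of basis multiplies the folded Wronskian by a constant. -/
theorem det_foldedWronskianMatrix_dvd {r k : ℕ} (γ : F) (U : Submodule F (degreeLT F k))
    (c : Basis (Fin r) F U) (b : Fin r → U) :
    (foldedWronskianMatrix γ fun j => ((c j : degreeLT F k) : F[X])).det ∣
      (foldedWronskianMatrix γ fun j => ((b j : degreeLT F k) : F[X])).det := by
  have h : (foldedWronskianMatrix γ fun j => ((b j : degreeLT F k) : F[X])) =
      (Matrix.of fun j l => C (c.repr (b j) l)) *
        foldedWronskianMatrix γ fun j => ((c j : degreeLT F k) : F[X]) := by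
    ext1 j i
    rw [Matrix.mul_apply]
    simp only [foldedWronskianMatrix, Matrix.of_apply]
    conv_lhs => rw [← c.sum_repr (b j)]
    simp only [AddSubmonoidClass.coe_finsetSum, Submodule.coe_smul, Polynomial.sum_comp,
      smul_eq_C_mul, mul_comp, C_comp]
  rw [h, Matrix.det_mul]
  exact dvd_mul_left _ _

/-- A space of polynomials of dimension `r` contains `r` polynomials of distinct degrees. -/
theorem exists_injective_natDegree {k : ℕ} (U : Submodule F (degreeLT F k)) :
    ∃ b : Fin (finrank F U) → U, (∀ j, b j ≠ 0) ∧
      Function.Injective fun j => ((b j : degreeLT F k) : F[X]).natDegree := by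
  classical
  -- The coefficients at the degrees attained in `U` determine an element of `U`, since a non-zero
  -- one has its leading coefficient among them. So at least dim U degrees are attained.
  set S : Finset ℕ := (Finset.range k).filter fun d =>
    ∃ f : U, f ≠ 0 ∧ ((f : degreeLT F k) : F[X]).natDegree = d with hS
  let φ : U →ₗ[F] (S → F) := LinearMap.pi fun d =>
    (lcoeff F d.1) ∘ₗ (degreeLT F k).subtype ∘ₗ U.subtype
  have hφ : Function.Injective φ := by
    rw [injective_iff_map_eq_zero]
    intro f hf
    by_contra hf0
    have hf0' : ((f : degreeLT F k) : F[X]) ≠ 0 := by simpa using hf0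
    have hmem : ((f : degreeLT F k) : F[X]).natDegree ∈ S := by
      refine Finset.mem_filter.2 ⟨Finset.mem_range.2 ?_, f, hf0, rfl⟩
      have := mem_degreeLT.1 (f : degreeLT F k).2
      exact (natDegree_lt_iff_degree_lt hf0').2 this
    have := congrFun hf ⟨_, hmem⟩
    exact hf0' (leadingCoeff_eq_zero.1 this)
  have hcard : finrank F U ≤ S.card := by
    simpa using LinearMap.finrank_le_finrank_of_injective hφ
  have hw : ∀ d : S, ∃ f : U, f ≠ 0 ∧ ((f : degreeLT F k) : F[X]).natDegree = d := fun d =>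
    (Finset.mem_filter.1 d.2).2
  choose g hg0 hgd using hw
  let ι : Fin (finrank F U) ↪ S :=
    (Fin.castLEEmb hcard).trans S.equivFin.symm.toEmbedding
  refine ⟨fun j => g (ι j), fun j => hg0 _, fun i j hij => ?_⟩
  simp only [hgd] at hij
  exact ι.injective (Subtype.ext hij)

/-- A finite-dimensional space has a basis that contains a basis of a given subspace. -/
theorem Submodule.exists_basis_card_filter_mem {V : Type*} [AddCommGroup V] [Module F V]
    [FiniteDimensional F V] (N : Submodule F V) :
    ∃ (c : Basis (Fin (finrank F V)) F V) (J : Finset (Fin (finrank F V))),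
      J.card = finrank F N ∧ ∀ j ∈ J, c j ∈ N := by
  classical
  obtain ⟨N', hN⟩ := Submodule.exists_isCompl N
  let c := ((finBasis F N).prod (finBasis F N')).map (N.prodEquivOfIsCompl N' hN)
  have hcard : Fintype.card (Fin (finrank F N) ⊕ Fin (finrank F N')) = finrank F V :=
    (finrank_eq_card_basis c).symm
  let e := Fintype.equivFinOfCardEq hcard
  refine ⟨c.reindex e, Finset.univ.map (Function.Embedding.inl.trans e.toEmbedding), by simp, ?_⟩
  intro j hj
  obtain ⟨i, -, rfl⟩ := Finset.mem_map.1 hj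
  simp [c]

/-- If a subspace of dimension `m` of `U` vanishes on `a, a γ, …, a γ ^ (r - 1)`, then `a` is a
root of multiplicity at least `m` of the folded Wronskian of a basis of `U`. -/
theorem pow_dvd_det_foldedWronskianMatrix {k : ℕ} {γ a : F} (U : Submodule F (degreeLT F k))
    (N : Submodule F (degreeLT F k))
    (hN : ∀ f ∈ N, ∀ i < finrank F U, (f : F[X]).eval (a * γ ^ i) = 0)
    (b : Fin (finrank F U) → U) :
    (X - C a) ^ finrank F ↥(U ⊓ N) ∣
      (foldedWronskianMatrix γ fun j => ((b j : degreeLT F k) : F[X])).det := by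
  classical
  obtain ⟨c, J, hJ, hc⟩ := Submodule.exists_basis_card_filter_mem (F := F) (V := U) (N.comap U.subtype)
  refine dvd_trans ?_ (det_foldedWronskianMatrix_dvd γ U c b)
  have hfr : finrank F ↥(U ⊓ N) = J.card := by
    rw [hJ, ← Submodule.finrank_map_subtype_eq U, Submodule.map_comap_subtype]
  rw [hfr, ← Matrix.det_transpose, Matrix.det_apply]
  -- Each term of the determinant takes one entry from every row, and all entries in the rows of `J`
  -- vanish at `a`.
  refine Finset.dvd_sum fun σ _ => ?_
  rw [Units.smul_def, zsmul_eq_mul]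
  refine Dvd.dvd.mul_left ?_ _
  have h1 : (X - C a) ^ J.card = ∏ j, if j ∈ J then X - C a else 1 := by
    rw [Finset.prod_ite_mem, Finset.univ_inter, Finset.prod_const]
  rw [h1]
  refine Finset.prod_dvd_prod_of_dvd _ _ fun j _ => ?_
  split_ifs with hj
  · rw [dvd_iff_isRoot, IsRoot.def, Matrix.transpose_apply, foldedWronskianMatrix_apply, eval_comp]
    have := hN _ (hc j hj) (σ j) (σ j).2
    simpa [mul_comm] using this
  · exact one_dvd _

/-- Folded Reed–Solomon codes are subspace designs. -/
theorem sum_finrank_inf_le {s k n : ℕ} {γ : F} {α : Fin n → F} (hk : k ≤ orderOf γ)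
    (hinj : Function.Injective fun p : Fin n × Fin s => α p.1 * γ ^ (p.2 : ℕ))
    (U : Submodule F (degreeLT F k)) (hU : finrank F U ≤ s) (N : Fin n → Submodule F (degreeLT F k))
    (hN : ∀ i, ∀ f ∈ N i, ∀ t < s, (f : F[X]).eval (α i * γ ^ t) = 0) :
    (s - finrank F U + 1) * ∑ i, finrank F ↥(U ⊓ N i) ≤ finrank F U * k := by
  -- For U = 0 there would be s + 1 starting points per column, one too many.
  rcases Nat.eq_zero_or_pos (finrank F U) with h0 | h0
  · have h1 : ∀ i, finrank F ↥(U ⊓ N i) = 0 := fun i =>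
      Nat.le_zero.1 (h0 ▸ Submodule.finrank_mono inf_le_left)
    simp [h1]
  obtain ⟨b, hb0, hb⟩ := exists_injective_natDegree U
  have hb0' : ∀ j, ((b j : degreeLT F k) : F[X]) ≠ 0 := fun j => by simpa using hb0 j
  have hbk : ∀ j, ((b j : degreeLT F k) : F[X]).natDegree < k := fun j =>
    (natDegree_lt_iff_degree_lt (hb0' j)).2 (mem_degreeLT.1 (b j : degreeLT F k).2)
  set w := (foldedWronskianMatrix γ fun j => ((b j : degreeLT F k) : F[X])).det with hw
  have hw0 : w ≠ 0 := det_foldedWronskianMatrix_ne_zero hb0' hb fun j => (hbk j).trans_le hk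
  have hwdeg : w.natDegree ≤ finrank F U * k := by
    refine (natDegree_det_foldedWronskianMatrix_le γ _).trans ?_
    have := Finset.sum_le_card_nsmul Finset.univ
      (fun j => ((b j : degreeLT F k) : F[X]).natDegree) k fun j _ => (hbk j).le
    simpa using this
  -- The starting points of windows of r = dim U consecutive evaluation points that stay inside a
  -- column of length s.
  let x : Fin n × Fin (s - finrank F U + 1) → F := fun p => α p.1 * γ ^ (p.2 : ℕ)
  have hx : Function.Injective x := fun p q hpq => by
    have hp := p.2.2
    have hq := q.2.2
    have := @hinj (p.1, ⟨p.2, by omega⟩) (q.1, ⟨q.2, by omega⟩) hpq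
    simp only [Prod.mk.injEq, Fin.mk.injEq] at this
    exact Prod.ext this.1 (Fin.ext this.2)
  have hdvd : ∏ p, (X - C (x p)) ^ finrank F ↥(U ⊓ N p.1) ∣ w := by
    refine Finset.prod_dvd_of_coprime (fun p _ q _ hpq => ?_) fun p _ => ?_
    · exact IsCoprime.pow (pairwise_coprime_X_sub_C hx hpq)
    · refine pow_dvd_det_foldedWronskianMatrix U (N p.1) (fun f hf i hi => ?_) b
      have hp := p.2.2
      have := hN p.1 f hf (p.2 + i) (by omega)
      rwa [pow_add, ← mul_assoc] at this
  refine le_trans (le_of_eq ?_) ((natDegree_le_of_dvd hdvd hw0).trans hwdeg)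
  rw [natDegree_prod _ _ fun p _ => pow_ne_zero _ (X_sub_C_ne_zero _)]
  simp only [natDegree_pow, natDegree_X_sub_C, mul_one]
  rw [Fintype.sum_prod_type]
  rw [Finset.mul_sum]
  refine Finset.sum_congr rfl fun i _ => Eq.symm ?_
  refine (Finset.sum_const (s := (Finset.univ : Finset (Fin (s - finrank F U + 1))))
    (finrank F ↥(U ⊓ N i))).trans ?_
  rw [Finset.card_univ, Fintype.card_fin, smul_eq_mul]

end Wronskian

/-! ### Folded Reed–Solomon codes: design property and rate -/

section Code

open Module

variable {F : Type*} [Field F] {s n : ℕ} {γ : F} {α : Fin n → F}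

/-- Cancelling the smaller power of γ leaves an equation α_i = α_j γ^v with v < s. It is excluded by
`disjoint` for i ≠ j, and by the order of γ for i = j and v > 0. -/
theorem IsFRSPoints.injective_prod (h : IsFRSPoints s γ α) :
    Function.Injective fun p : Fin n × Fin s => α p.1 * γ ^ (p.2 : ℕ) := by
  have key : ∀ (i j : Fin n) (t u : Fin s), t ≤ u → α i * γ ^ (t : ℕ) = α j * γ ^ (u : ℕ) →
      i = j ∧ t = u := by
    intro i j t u htu heq
    have hn : 0 < n := i.pos
    have hs : 0 < s := t.pos
    have hord : 0 < orderOf γ := (Nat.mul_pos hs hn).trans_le h.order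
    -- `orderOf` takes the value 0 on elements of infinite order, in particular at 0.
    have hγ : γ ≠ 0 := by
      rintro rfl
      have := pow_orderOf_eq_one (0 : F)
      rw [zero_pow hord.ne'] at this
      exact zero_ne_one this
    have htu' : (t : ℕ) ≤ u := htu
    have hu : (u : ℕ) = (u - t : ℕ) + t := by omega
    rw [hu, pow_add, ← mul_assoc] at heq
    have heq' : α i = α j * γ ^ (u - t : ℕ) := mul_right_cancel₀ (pow_ne_zero _ hγ) heq
    have hlt : (u - t : ℕ) < s := by have := u.2; omega
    have hij : i = j := by
      by_contra hne
      exact h.disjoint j i (Ne.symm hne) _ hlt heq'.symm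
    subst hij
    refine ⟨rfl, ?_⟩
    have h1 : γ ^ (u - t : ℕ) = 1 :=
      mul_left_cancel₀ (h.ne_zero i) (by rw [← heq', mul_one])
    by_contra hne
    have hne' : (t : ℕ) ≠ u := fun h' => hne (Fin.ext h')
    have h2 := orderOf_le_of_pow_eq_one (by omega) h1
    have h3 : s ≤ s * n := Nat.le_mul_of_pos_right s hn
    have h4 := h.order
    omega
  rintro ⟨i, t⟩ ⟨j, u⟩ heq
  rcases le_total t u with htu | htu
  · obtain ⟨rfl, rfl⟩ := key i j t u htu heq
    rfl
  · obtain ⟨rfl, rfl⟩ := key j i u t htu heq.symm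
    rfl

/-- The `i`-th column of the codeword of a polynomial of degree less than `k`. -/
noncomputable def frsColumn (s k : ℕ) {n : ℕ} (γ : F) (α : Fin n → F) (i : Fin n) :
    degreeLT F k →ₗ[F] (Fin s → F) :=
  LinearMap.pi fun t => leval (α i * γ ^ (t : ℕ)) ∘ₗ (degreeLT F k).subtype

@[simp]
theorem frsColumn_apply (k : ℕ) (i : Fin n) (f : degreeLT F k) (t : Fin s) :
    frsColumn s k γ α i f t = (f : F[X]).eval (α i * γ ^ (t : ℕ)) := rfl

theorem frsCode_eq_range (s k : ℕ) (γ : F) (α : Fin n → F) :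
    frsCode s k γ α = Set.range fun (f : degreeLT F k) i => frsColumn s k γ α i f := by
  ext c
  constructor
  · rintro ⟨f, hf, hc⟩
    exact ⟨⟨f, mem_degreeLT.2 hf⟩, by ext i t; exact (hc i t).symm⟩
  · rintro ⟨f, rfl⟩
    exact ⟨f, mem_degreeLT.1 f.2, fun i t => rfl⟩

theorem IsFRSPoints.frsColumn_injective (h : IsFRSPoints s γ α) {k : ℕ} (hk : k ≤ s * n) :
    Function.Injective fun (f : degreeLT F k) i => frsColumn s k γ α i f := by
  intro f g hfg
  refine Subtype.ext ?_
  refine eq_of_degrees_lt_of_eval_index_eq (Finset.univ : Finset (Fin n × Fin s))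
    (h.injective_prod.injOn) ?_ ?_ fun p _ => congrFun (congrFun hfg p.1) p.2
  all_goals
    refine (mem_degreeLT.1 (Subtype.prop _)).trans_le ?_
    simp only [Finset.card_univ, Fintype.card_prod, Fintype.card_fin]
    exact_mod_cast hk.trans (mul_comm s n).le

/-- By interpolation. The rate thus saturates at 1, so that R + ε ≤ 1 later forces k ≤ sn. -/
theorem IsFRSPoints.frsCode_eq_univ (h : IsFRSPoints s γ α) {k : ℕ} (hk : s * n ≤ k) :
    frsCode s k γ α = Set.univ := by
  refine Set.eq_univ_of_forall fun c => ?_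
  have hinj := h.injective_prod.injOn (s := ((Finset.univ : Finset (Fin n × Fin s)) : Set _))
  refine ⟨Lagrange.interpolate Finset.univ (fun p : Fin n × Fin s => α p.1 * γ ^ (p.2 : ℕ))
    fun p => c p.1 p.2, ?_, fun i t => ?_⟩
  · refine (Lagrange.degree_interpolate_lt _ hinj).trans_le ?_
    simp only [Finset.card_univ, Fintype.card_prod, Fintype.card_fin]
    exact_mod_cast (mul_comm n s).le.trans hk
  · exact (Lagrange.eval_interpolate_at_node (fun p : Fin n × Fin s => c p.1 p.2) hinj
      (Finset.mem_univ (i, t))).symm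

/-- In dimension r ≤ D the Wronskian bound gives an average of at most r·Rs/(s - r + 1), and the
denominator exceeds s - D. -/
theorem IsFRSPoints.isSubspaceDesign (h : IsFRSPoints s γ α) {k D : ℕ} {R ρ : ℝ} (hn : 0 < n)
    (hk : k ≤ s * n) (hR : (k : ℝ) = R * s * n) (hDs : D ≤ s) (hρ : 0 ≤ ρ)
    (hRρ : R * s ≤ ρ * (s - D)) : IsSubspaceDesign (frsColumn s k γ α) ρ D := by
  intro U hU
  have h1 := sum_finrank_inf_le (hk.trans h.order) h.injective_prod U (hU.trans hDs)
    (fun i => LinearMap.ker (frsColumn s k γ α i))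
    fun i f hf t ht => congrFun (LinearMap.mem_ker.1 hf) ⟨t, ht⟩
  set r := finrank F U with hr
  have h2 : ((s - r + 1 : ℕ) : ℝ) * ∑ i, (finrank F ↥(U ⊓ LinearMap.ker (frsColumn s k γ α i)) : ℝ)
      ≤ r * k := by exact_mod_cast h1
  have hrD : (r : ℝ) ≤ D := by exact_mod_cast hU
  rw [Nat.cast_add, Nat.cast_sub (hU.trans hDs), Nat.cast_one] at h2
  have hrs : (D : ℝ) ≤ s := by exact_mod_cast hDs
  rw [Fintype.card_fin]
  refine le_of_mul_le_mul_left (h2.trans ?_) (by linarith : (0 : ℝ) < s - r + 1)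
  calc (r : ℝ) * k = R * s * (r * n) := by rw [hR]; ring
    _ ≤ ρ * (s - r + 1) * (r * n) := by
      refine mul_le_mul_of_nonneg_right (hRρ.trans ?_) (by positivity)
      gcongr
      linarith
    _ = _ := by ring

variable [Finite F]

theorem codeRate_of_ncard_eq (hs : 0 < s) {m : ℕ} {C : Set (Fin n → Fin s → F)}
    (hC : C.ncard = Nat.card F ^ m) : codeRate C = m / s / n := by
  have hq : (1 : ℝ) < Nat.card F := by exact_mod_cast Finite.one_lt_card
  have hlog : Real.log (Nat.card F) ≠ 0 := (Real.log_pos hq).ne'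
  have hs' : (s : ℝ) ≠ 0 := by exact_mod_cast hs.ne'
  have hA : Nat.card (Fin s → F) = Nat.card F ^ s := by simp [Nat.card_fun]
  rw [codeRate, hC, hA, Real.logb, Nat.cast_pow, Nat.cast_pow, Real.log_pow, Real.log_pow,
    mul_div_mul_right _ _ hlog]

theorem IsFRSPoints.codeRate_of_le (h : IsFRSPoints s γ α) (hs : 0 < s) {k : ℕ} (hk : k ≤ s * n) :
    codeRate (frsCode s k γ α) = k / s / n := by
  refine codeRate_of_ncard_eq hs ?_
  rw [frsCode_eq_range, ← Set.image_univ, Set.ncard_image_of_injective _ (h.frsColumn_injective hk),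
    Set.ncard_univ, Nat.card_congr (degreeLTEquiv F k).toEquiv]
  simp [Nat.card_fun]

theorem IsFRSPoints.codeRate_of_ge (h : IsFRSPoints s γ α) (hs : 0 < s) (hn : 0 < n) {k : ℕ}
    (hk : s * n ≤ k) : codeRate (frsCode s k γ α) = 1 := by
  have hs' : (s : ℝ) ≠ 0 := by exact_mod_cast hs.ne'
  have hn' : (n : ℝ) ≠ 0 := by exact_mod_cast hn.ne'
  rw [codeRate_of_ncard_eq hs (m := s * n)]
  · push_cast
    field_simp
  · rw [h.frsCode_eq_univ hk, Set.ncard_univ]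
    simp [Nat.card_fun, ← pow_mul]

end Code

/-! ### The list-size bound -/

open Classical in
theorem mem_recoveryList_agree {A : Type*} {n : ℕ} (hn : 0 < n) {C : Set (Fin n → A)} {κ : ℝ}
    {L : Fin n → Finset A} {c : Fin n → A} (hc : c ∈ recoveryList C (1 - κ) L) :
    κ * n ≤ (Finset.univ.filter fun i => c i ∈ L i).card := by
  obtain ⟨y, hy, hd⟩ := (fracDistToSet_le_iff _ _ _).1 hc.2
  have hn' : (0 : ℝ) < n := by exact_mod_cast hn
  rw [fracDist, div_le_iff₀ hn'] at hd
  have h1 : (Finset.univ : Finset (Fin n)) ⊆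
      (Finset.univ.filter fun i => c i ≠ y i) ∪ Finset.univ.filter fun i => c i ∈ L i := by
    intro i _
    by_cases h : c i = y i
    · have := hy i trivial
      rw [← h] at this
      simp only [Finset.mem_union, Finset.mem_filter, Finset.mem_univ, true_and]
      exact Or.inr this
    · simp [h]
  have h2 := (Finset.card_le_card h1).trans (Finset.card_union_le _ _)
  rw [Finset.card_univ, Fintype.card_fin] at h2
  have h3 : (n : ℝ) ≤ hammingDist c y + (Finset.univ.filter fun i => c i ∈ L i).card := by
    exact_mod_cast h2
  linarith

theorem ncard_recoveryList_frsCode_le {F : Type*} [Field F] [Finite F] {s n k ℓ : ℕ} {γ : F}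
    {α : Fin n → F} {R ε : ℝ} (hε : 0 < ε) (hR : 0 < R) (hκ1 : R + ε ≤ 1) (hn : 0 < n)
    (hℓ : 0 < ℓ) (h : IsFRSPoints s γ α) (hrate : codeRate (frsCode s k γ α) = R)
    (hs : 16 * (R + ε) * ℓ / ε ^ 2 < (s : ℝ)) (L : Fin n → Finset (Fin s → F))
    (hL : ∀ i, (L i).card = ℓ) :
    ((recoveryList (frsCode s k γ α) (1 - R - ε) L).ncard : ℝ) ≤
      9 * (ℓ / ε ^ 2) *
        (ℓ : ℝ) ^ (2 * Real.log (2 * Real.exp 1 * ℓ / (R + ε)) * ((R + ε) / ε)) := by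
  classical
  have hℓ1 : (1 : ℝ) ≤ ℓ := by exact_mod_cast hℓ
  have hℓ0 : (0 : ℝ) < ℓ := by linarith
  set κ := R + ε with hκ
  have hκ0 : 0 < κ := by positivity
  have hs0 : (0 : ℝ) < s := lt_of_le_of_lt (by positivity) hs
  have hs0' : 0 < s := by exact_mod_cast hs0
  have hn0 : (0 : ℝ) < n := by exact_mod_cast hn
  have hk : k ≤ s * n := by
    by_contra! hlt
    rw [h.codeRate_of_ge hs0' hn hlt.le] at hrate
    linarith
  rw [h.codeRate_of_le hs0' hk] at hrate
  have hkR : (k : ℝ) = R * s * n := by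
    rw [← hrate]
    field_simp
  -- The least D with ℓ ≤ D(κ - ρ), for the gap κ - ρ = ε/2.
  set D := ⌈2 * ℓ / ε⌉₊
  have hDlow : 2 * ℓ / ε ≤ D := Nat.le_ceil _
  have hε1 : ε ≤ 1 := by linarith
  have hone : 1 ≤ ℓ / ε := by rw [one_le_div hε]; linarith
  have hDup : (D : ℝ) ≤ 4 * ℓ / ε := by
    have h1 : (D : ℝ) < 2 * ℓ / ε + 1 := Nat.ceil_lt_add_one (by positivity)
    have h2 : 4 * ℓ / ε = 2 * ℓ / ε + 2 * (ℓ / ε) := by ring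
    linarith
  have hsκ : 8 * κ * ℓ / ε ≤ ε / 2 * s := by
    have : ε / 2 * (16 * κ * ℓ / ε ^ 2) ≤ ε / 2 * s := by gcongr
    refine le_trans (le_of_eq ?_) this
    field_simp
    norm_num
  -- This yields Rs ≤ (R + ε/2)(s - D), as the design property needs. The bound on `s` leaves a
  -- factor 2 to spare.
  have hκD : κ * D ≤ ε / 2 * s := by
    have h1 : κ * D ≤ κ * (4 * ℓ / ε) := by gcongr
    have h2 : 8 * κ * ℓ / ε = κ * (4 * ℓ / ε) + κ * (4 * ℓ / ε) := by ring
    have h3 : 0 ≤ κ * (4 * ℓ / ε) := by positivity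
    linarith
  have hDs : D ≤ s := by
    have h1 : ε * D ≤ ε * s := by
      have h2 : ε * D ≤ κ * D := by gcongr; linarith
      have h3 : 0 ≤ ε * s := by positivity
      linarith
    exact_mod_cast le_of_mul_le_mul_left h1 hε
  have hdesign : IsSubspaceDesign (frsColumn s k γ α) (R + ε / 2) D := by
    refine h.isSubspaceDesign hn hk hkR hDs (by positivity) ?_
    have h1 : (R + ε / 2) * D ≤ κ * D := by gcongr; linarith
    nlinarith
  have : Finite (degreeLT F k) := Finite.of_equiv _ (degreeLTEquiv F k).toEquiv.symm
  have : Fintype (degreeLT F k) := Fintype.ofFinite _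
  let T : Finset (degreeLT F k) := Finset.univ.filter fun f =>
    κ * Fintype.card (Fin n) ≤ (Finset.univ.filter fun i => frsColumn s k γ α i f ∈ L i).card
  have hT : ∀ f ∈ T, κ * Fintype.card (Fin n) ≤
      (Finset.univ.filter fun i => frsColumn s k γ α i f ∈ L i).card :=
    fun f hf => (Finset.mem_filter.1 hf).2
  have hsub : recoveryList (frsCode s k γ α) (1 - R - ε) L ⊆
      (fun (f : degreeLT F k) i => frsColumn s k γ α i f) '' (T : Set (degreeLT F k)) := by
    intro c hc
    have hc1 := hc.1
    rw [frsCode_eq_range] at hc1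
    obtain ⟨f, rfl⟩ := hc1
    refine ⟨f, Finset.mem_coe.2 (Finset.mem_filter.2 ⟨Finset.mem_univ _, ?_⟩), rfl⟩
    rw [sub_sub, ← hκ] at hc
    rw [Fintype.card_fin]
    convert mem_recoveryList_agree hn hc
  have hcard : (recoveryList (frsCode s k γ α) (1 - R - ε) L).ncard ≤ T.card := by
    refine (Set.ncard_le_ncard hsub (T.finite_toSet.image _)).trans ?_
    exact (Set.ncard_image_le T.finite_toSet).trans (Set.ncard_coe_finset T).le
  have hι : 0 < Fintype.card (Fin n) := by simpa using hn
  have hρ : R + ε / 2 = κ - ε / 2 := by rw [hκ]; ring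
  rw [hρ] at hdesign
  obtain ⟨d, hdD, hmain⟩ := hdesign.card_le_of_ceil_le hι hℓ hε hκ0 hDlow hL T
    fun f hf => by convert hT f hf
  have hd4 : (d : ℝ) ≤ 4 * ℓ / ε := by
    have : (d : ℝ) < D := by exact_mod_cast hdD
    linarith
  have hexp : listExponent (2 * κ / ε) d ≤
      2 * Real.log (2 * Real.exp 1 * ℓ / κ) * (κ / ε) := by
    refine (listExponent_le_of_le (by positivity) ?_ hd4).trans (le_of_eq ?_)
    · gcongr <;> linarith
    · have h1 : 2 * Real.exp 1 * ℓ / κ = Real.exp 1 * (4 * ℓ / ε / (2 * κ / ε)) := by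
        field_simp
        norm_num
      rw [h1, Real.log_mul (Real.exp_ne_zero _) (by positivity), Real.log_exp]
      ring
  -- The source of K = 9: d ≤ 4ℓ/ε contributes 8, and 1 ≤ ℓ/ε² absorbs the summand 1.
  have hpre : 2 / ε * (d : ℝ) + 1 ≤ 9 * (ℓ / ε ^ 2) := by
    have h1 : 2 / ε * (d : ℝ) ≤ 2 / ε * (4 * ℓ / ε) := by gcongr
    have h2 : 2 / ε * (4 * ℓ / ε) = 8 * (ℓ / ε ^ 2) := by ring
    have h3 : 1 ≤ ℓ / ε ^ 2 := by
      rw [one_le_div (by positivity)]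
      nlinarith
    linarith
  calc ((recoveryList (frsCode s k γ α) (1 - R - ε) L).ncard : ℝ) ≤ T.card := by
        exact_mod_cast hcard
    _ ≤ (ℓ : ℝ) ^ listExponent (2 * κ / ε) d * (2 / ε * d + 1) := hmain
    _ ≤ (ℓ : ℝ) ^ (2 * Real.log (2 * Real.exp 1 * ℓ / κ) * (κ / ε)) * (9 * (ℓ / ε ^ 2)) := by
        gcongr
    _ = _ := mul_comm _ _

theorem mainTheorem4 :
    ∃ K : ℝ, 0 < K ∧
      ∀ (ℓ : ℕ) (ε R : ℝ), 0 < ε → 0 < R →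
      ∀ (F : Type*) [Field F] [Finite F] (s n k : ℕ) (γ : F) (α : Fin n → F),
        0 < n → 0 < k → IsFRSPoints s γ α →
        codeRate (frsCode s k γ α) = R →
        16 * (R + ε) * ℓ / ε ^ 2 < (s : ℝ) →
        ∀ L : Fin n → Finset (Fin s → F), (∀ i, (L i).card = ℓ) →
          ((recoveryList (frsCode s k γ α) (1 - R - ε) L).ncard : ℝ) ≤
            K * (ℓ / ε ^ 2) *
              (ℓ : ℝ) ^ (2 * Real.log (2 * Real.exp 1 * ℓ / (R + ε)) * ((R + ε) / ε)) := by
  refine ⟨9, by norm_num, fun ℓ ε R hε hR F _ _ s n k γ α hn _ h hrate hs L hL => ?_⟩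
  -- The degenerate cases ℓ = 0 and R + ε > 1 have an empty list; a listed word rules both out.
  rcases (recoveryList (frsCode s k γ α) (1 - R - ε) L).eq_empty_or_nonempty with h0 | ⟨c, hc⟩
  · rw [h0, Set.ncard_empty, Nat.cast_zero]
    positivity
  obtain ⟨y, hy, hd⟩ := (fracDistToSet_le_iff _ _ _).1 hc.2
  have hκ1 : R + ε ≤ 1 := by
    have : 0 ≤ fracDist c y := by unfold fracDist; positivity
    linarith
  have hℓ : 0 < ℓ := hL ⟨0, hn⟩ ▸ Finset.card_pos.2 ⟨_, hy ⟨0, hn⟩ trivial⟩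
  exact ncard_recoveryList_frsCode_le hε hR hκ1 hn hℓ h hrate hs L hL
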